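/- For complex $x,q$ and an integer $N\ge 0$ let $(x;q)_N=\prod_{k=0}^{N-1}(1-xq^k)$ and write $$\left[\begin{matrix}x_1,\dots,x_r\\ y_1,\dots,y_s\end{matrix}\,\Big|\,q\right]_N=\frac{(x_1;q)_N\cdots(x_r;q)_N}{(y_1;q)_N\cdots(y_s;q)_N},\qquad {}_4\phi_3\left[\begin{matrix}x_1,x_2,x_3,x_4\\ y_1,y_2,y_3\end{matrix}\,\Big|\,q;z\right]=\sum_{k\ge 0}\left[\begin{matrix}x_1,x_2,x_3,x_4\\ q,y_1,y_2,y_3\end{matrix}\,\Big|\,q\right]_k z^k .$$ Let $\ell,m,n$ be nonnegative integers, let $q$ be a nonzero complex number that is not a root of unity, and let $a,c$ be nonzero complex numbers such that no zero factors appear in the denominators below (for the series on the left, which terminates, only the terms with $k\le n$ matter). Then $$\begin{aligned} &{}_4\phi_3\left[\begin{matrix}a,\;c,\;q^{-n},\;-q^{1-\ell+m+n}a/c\\ q^{1-\ell}a/c,\;q^{1+m+n}a,\;-q^{-n}c\end{matrix}\,\Big|\,q;q\right] =\left[\begin{matrix}a,\;c\\ q^{\ell-1}c^2,\;q^{1-\ell}a/c\end{matrix}\,\Big|\,q\right]_{\ell}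 \left[\begin{matrix}q^{1+m+n},\;-qa/c\\ q^{1+m+n}a,\;-q/c\end{matrix}\,\Big|\,q\right]_{n}\\ &\quad\times\sum_{i=0}^{\ell}\sum_{j=0}^{m}(-1)^{j}q^{\ell i-nj+\binom{j+1}{2}}\Big(\frac{c}{a}\Big)^i\,\frac{1-q^{1-2\ell+2i}/c^2}{1-q^{1-2\ell}/c^2} \left[\begin{matrix}q^{-\ell},\;q^{1-\ell}a/c^2,\;q^{1-2\ell}/c^2\\ q,\;q^{1-\ell}/a,\;q^{2-\ell}/c^2\end{matrix}\,\Big|\,q\right]_i\\ &\quad\times\left[\begin{matrix}q^{-m},\;q^{-m-n},\;-q^{-m-n},\;q^{\ell-i}a,\;q^{1-\ell+i}a/c^2\\ q,\;qa/c,\;-qa/c,\;q^{-m-2n},\;q^{j-2m-2n-1}\end{matrix}\,\Big|\,q\right]_j \left[\begin{matrix}q^{1+\ell-i+j}a,\;q^{2-\ell+i+j}a/c^2\\ q,\;q^{2+2j}a^2/c^2\end{matrix}\,\Big|\,q^2\right]_{m+n-j}. \end{aligned}$$ -/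

import Mathlib

/-- The `q`-shifted factorial `(x; q)_n = ∏_{k=0}^{n-1} (1 - x q^k)`. -/
def qPoch (x q : ℂ) (n : ℕ) : ℂ := ∏ k ∈ Finset.range n, (1 - x * q ^ k)

/-- The fraction form of the `q`-shifted factorial:
`((num 0; q)_n (num 1; q)_n ⋯) / ((den 0; q)_n (den 1; q)_n ⋯)`. -/
noncomputable def qFrac {r s : ℕ} (num : Fin r → ℂ) (den : Fin s → ℂ) (q : ℂ) (n : ℕ) : ℂ :=
  (∏ i, qPoch (num i) q n) / ∏ i, qPoch (den i) q n

/-- The basic hypergeometric series `_{1+r}φ_r` with numerator parameters `a 0, …, a r`,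
denominator parameters `b 0, …, b (r-1)`, base `q` and argument `z`. -/
noncomputable def basicHyp {r : ℕ} (a : Fin (r + 1) → ℂ) (b : Fin r → ℂ) (q z : ℂ) : ℂ :=
  ∑' k : ℕ, qFrac a (Matrix.vecCons q b) q k * z ^ k

/-!
The identity is a coefficient comparison in the products `(u; q)_k (v; q)_k` with `uv` fixed.
Put `w = a / c`, `M = m + n`, `p = q w²`.

Sears' transformation (`sum_sears`) turns the series on the left into a multiple of
`∑_{k ≤ n} (q⁻ⁿ, -q^{-M}, a, β; q)_k q^k / (q, q^{-M-n}, -qw, D; q)_k`, where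
`β = q^{1-ℓ} a / c²` and `D = q^{1-ℓ} a / c`. So it is enough to see that the double sum on the
right is the same series.

* In the double sum the index `i` enters the sum over `j` only through `u = q^{ℓ-i} a` and
  `v = q^{1-ℓ+i} a / c²`, and `uv = p` does not depend on `i`. By the terminating `q`-Watson sum
  of Andrews (`sum_watson`), applied to `u q^j` and `v q^j`, each term of the sum over `j` expands
  in the products `(u; q)_k (v; q)_k`. The coefficient of each product is then a terminating
  very-well-poised `₆φ₅` sum, and `sum_watson_expansion` evaluates the whole sum over `j` as
  `∑_{k ≤ n} (q⁻ⁿ, -q^{-M}, u, v; q)_k q^k / (q, q^{-M-n}, qw, -qw; q)_k`.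
* For fixed `k`, the sum over `i` of the remaining factors times `(u; q)_k (v; q)_k` is again a
  `₆φ₅` sum of the same kind (`vwp_evaluation`). It equals
  `(a, β, qw; q)_k / (D; q)_k`, which is what the transformed left side requires.

Both `₆φ₅` sums have a parameter equal to the square root of `q` times the leading parameter, so
that only the special case `sum_vwp` is needed; it is proved by telescoping. Sears' transformation
follows from the `q`-Pfaff–Saalschütz sum applied twice. The `q`-Saalschütz and `q`-Watson sums are
both proved by induction on the length: passing from `n` to `n + 1` multiplies the closed form by
a factor linear in `u + v`, and `sum_mul_of_basis_step` translates this multiplication into a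
recurrence for the coefficients.
-/

open Finset

/-! ### Shifted factorials -/

theorem qPoch_zero (x q : ℂ) : qPoch x q 0 = 1 := by simp [qPoch]

theorem qPoch_succ (x q : ℂ) (n : ℕ) :
    qPoch x q (n + 1) = qPoch x q n * (1 - x * q ^ n) := by
  simp [qPoch, Finset.prod_range_succ]

theorem qPoch_add (x q : ℂ) (m n : ℕ) :
    qPoch x q (m + n) = qPoch x q m * qPoch (x * q ^ m) q n := by
  simp only [qPoch, Finset.prod_range_add]
  congr 1
  exact Finset.prod_congr rfl fun k _ => by ring

theorem qPoch_succ_left (x q : ℂ) (n : ℕ) :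
    qPoch x q (n + 1) = (1 - x) * qPoch (x * q) q n := by
  rw [add_comm, qPoch_add]
  simp [qPoch]

theorem qPoch_ne_zero_iff {x q : ℂ} {n : ℕ} :
    qPoch x q n ≠ 0 ↔ ∀ k < n, 1 - x * q ^ k ≠ 0 := by
  simp [qPoch, Finset.prod_ne_zero_iff]

theorem qPoch_ne_zero_of_le {x q : ℂ} {m n : ℕ} (h : qPoch x q n ≠ 0) (hmn : m ≤ n) :
    qPoch x q m ≠ 0 := by
  rw [qPoch_ne_zero_iff] at h ⊢
  exact fun k hk => h k (hk.trans_le hmn)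

theorem one_sub_pow_ne_zero {q : ℂ} (hq : ∀ k : ℕ, 0 < k → q ^ k ≠ 1) (k : ℕ) :
    1 - q * q ^ k ≠ 0 := by
  rw [← pow_succ']
  exact sub_ne_zero.2 (hq _ k.succ_pos).symm

theorem qPoch_self_ne_zero {q : ℂ} (hq : ∀ k : ℕ, 0 < k → q ^ k ≠ 1) (n : ℕ) :
    qPoch q q n ≠ 0 := by
  rw [qPoch_ne_zero_iff]
  intro k _ h
  exact hq (k + 1) k.succ_pos (by rw [pow_succ']; linear_combination -h)

theorem qPoch_eq_zero {x q : ℂ} {k n : ℕ} (hk : k < n) (h : x * q ^ k = 1) :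
    qPoch x q n = 0 :=
  Finset.prod_eq_zero (Finset.mem_range.2 hk) (by rw [h, sub_self])

/-- Reversal of the order of the factors of a `q`-shifted factorial. -/
theorem qPoch_reverse {q : ℂ} (x y : ℂ) (n : ℕ) (h : x * y * q ^ n = q) (hq0 : q ≠ 0) :
    qPoch y q n = (-y) ^ n * q ^ n.choose 2 * qPoch x q n := by
  have key : ∀ k < n, 1 - y * q ^ k = -y * q ^ k * (1 - x * q ^ (n - 1 - k)) := by
    intro k hk
    obtain ⟨r, rfl⟩ : ∃ r, n = k + 1 + r := ⟨n - (k + 1), by omega⟩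
    have hr : k + 1 + r - 1 - k = r := by omega
    rw [hr]
    have : x * y * q ^ k * q ^ r = 1 := by
      apply mul_left_cancel₀ hq0
      linear_combination h
    linear_combination -this
  rw [qPoch, Finset.prod_congr rfl fun k hk => key k (Finset.mem_range.1 hk),
    Finset.prod_mul_distrib, Finset.prod_mul_distrib, Finset.prod_range_reflect
      (fun k => 1 - x * q ^ k) n, Finset.prod_pow_eq_pow_sum, Finset.sum_range_id,
    Nat.choose_two_right]
  simp [qPoch]

/-- For `z = q⁻ⁿ` and `F = q^{1-n} / G`, the reversals of `(z; q)_k` and `(F; q)_k` produce powers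
of `q` that cancel in the quotient. -/
theorem qPoch_ratio_reverse {q : ℂ} (F G z : ℂ) (n k : ℕ) (hk : k ≤ n) (hq0 : q ≠ 0)
    (hFG : F * G * q ^ n = q) (hz : z * q ^ n = 1)
    (hq : ∀ k : ℕ, 0 < k → q ^ k ≠ 1) (hG : qPoch G q n ≠ 0) :
    qPoch z q k * q ^ k / qPoch F q k =
      G ^ k * (qPoch q q n * qPoch G q (n - k)) / (qPoch q q (n - k) * qPoch G q n) := by
  obtain ⟨r, rfl⟩ : ∃ r, n = r + k := ⟨n - k, by omega⟩
  rw [Nat.add_sub_cancel]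
  have hF0 : F ≠ 0 := by rintro rfl; simp at hFG; exact hq0 hFG.symm
  have h1 := qPoch_reverse (q * q ^ r) z k (by linear_combination q * hz) hq0
  have h2 := qPoch_reverse (G * q ^ r) F k (by linear_combination hFG) hq0
  rw [qPoch_add] at hG
  have hG1 := left_ne_zero_of_mul hG
  have hG2 := right_ne_zero_of_mul hG
  rw [h1, h2, qPoch_add q, qPoch_add G]
  have := qPoch_self_ne_zero hq r
  have e : (-z) ^ k * q ^ k = G ^ k * (-F) ^ k := by
    rw [← mul_pow, ← mul_pow]; congr 1
    apply mul_right_cancel₀ (pow_ne_zero (r + k) hq0)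
    linear_combination -q * hz + hFG
  have hF' : (-F) ^ k ≠ 0 := pow_ne_zero _ (neg_ne_zero.2 hF0)
  have hqc : q ^ k.choose 2 ≠ 0 := pow_ne_zero _ hq0
  rw [div_eq_div_iff (by positivity) (by positivity)]
  linear_combination q ^ k.choose 2 * qPoch (q * q ^ r) q k * qPoch q q r * qPoch G q r *
    qPoch (G * q ^ r) q k * e

/-! ### The `q`-Pfaff–Saalschütz sum and Sears' transformation -/

/-- Multiplication of an expansion `∑ g j φ j` by a factor `L` that decomposes, relative to each
`φ j`, as `A j · (φ (j + 1) / φ j) + C j`. -/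
theorem sum_mul_of_basis_step (φ A B C g g' : ℕ → ℂ) (L : ℂ) (k : ℕ)
    (hφ : ∀ j, φ (j + 1) = φ j * B j) (hL : ∀ j ≤ k, L = A j * B j + C j)
    (h0 : g' 0 = C 0 * g 0)
    (hs : ∀ j < k, g' (j + 1) = A j * g j + C (j + 1) * g (j + 1))
    (hk : g' (k + 1) = A k * g k) :
    ∑ j ∈ range (k + 1 + 1), g' j * φ j = L * ∑ j ∈ range (k + 1), g j * φ j := by
  have e1 : L * ∑ j ∈ range (k + 1), g j * φ j =
      ∑ j ∈ range (k + 1), (A j * g j * φ (j + 1) + C j * g j * φ j) := by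
    rw [Finset.mul_sum]
    refine Finset.sum_congr rfl fun j hj => ?_
    rw [hL j (by simpa [Nat.lt_succ_iff] using hj), hφ]
    ring
  rw [e1, Finset.sum_add_distrib, Finset.sum_range_succ' (fun j => C j * g j * φ j),
    Finset.sum_range_succ (fun j => A j * g j * φ (j + 1)), Finset.sum_range_succ' _ (k + 1),
    Finset.sum_range_succ _ k, h0, hk]
  have : ∑ j ∈ range k, g' (j + 1) * φ (j + 1) =
      ∑ j ∈ range k, A j * g j * φ (j + 1) +
        ∑ j ∈ range k, C (j + 1) * g (j + 1) * φ (j + 1) := by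
    rw [← Finset.sum_add_distrib]
    refine Finset.sum_congr rfl fun j hj => ?_
    rw [hs j (by simpa using hj)]
    ring
  rw [this]
  ring

/-- The `q`-Pfaff–Saalschütz sum, cleared of the denominators that depend on the parameters. -/
theorem sum_saalschutz {q : ℂ} (hq : ∀ k : ℕ, 0 < k → q ^ k ≠ 1) (α β X : ℂ)
    (k : ℕ) :
    ∑ j ∈ range (k + 1), qPoch (α * β * X * q ^ j) q (k - j) * qPoch X q (k - j) * X ^ j /
        (qPoch q q j * qPoch q q (k - j)) * (qPoch α q j * qPoch β q j) =
      qPoch (α * X) q k * qPoch (β * X) q k / qPoch q q k := by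
  induction k with
  | zero => simp [qPoch_zero]
  | succ k ih =>
    have hk1 := one_sub_pow_ne_zero hq k
    have hn := qPoch_self_ne_zero hq
    -- `(1 - αX q^k)(1 - βX q^k)` is `q^(k-j) X (1 - α q^j)(1 - β q^j)` plus a remainder that
    -- depends on `α` and `β` only through `αβ`; the recurrence is then Pascal's `q`-rule
    have step := sum_mul_of_basis_step (fun j => qPoch α q j * qPoch β q j)
      (fun j => q ^ (k - j) * X) (fun j => (1 - α * q ^ j) * (1 - β * q ^ j))
      (fun j => (1 - q ^ (k - j) * X) * (1 - q ^ (k + j) * (X * (α * β))))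
      (fun j => qPoch (α * β * X * q ^ j) q (k - j) * qPoch X q (k - j) * X ^ j /
        (qPoch q q j * qPoch q q (k - j)))
      (fun j => (1 - q * q ^ k) * (qPoch (α * β * X * q ^ j) q (k + 1 - j) *
        qPoch X q (k + 1 - j) * X ^ j / (qPoch q q j * qPoch q q (k + 1 - j))))
      ((1 - α * X * q ^ k) * (1 - β * X * q ^ k)) k
      (fun j => by simp only [qPoch_succ]; ring)
      (fun j hj => by
        obtain ⟨r, rfl⟩ : ∃ r, k = j + r := ⟨k - j, by omega⟩
        rw [Nat.add_sub_cancel_left]; ring)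
      (by
        simp only [Nat.sub_zero, qPoch_zero, pow_zero, qPoch_succ]
        have := hn k
        field_simp
        ring)
      (fun j hj => by
        obtain ⟨r, rfl⟩ : ∃ r, k = j + 1 + r := ⟨k - (j + 1), by omega⟩
        have e1 : j + 1 + r + 1 - (j + 1) = r + 1 := by omega
        have e2 : j + 1 + r - j = r + 1 := by omega
        have e3 : j + 1 + r - (j + 1) = r := by omega
        simp only [e1, e2, e3]
        rw [qPoch_succ_left (α * β * X * q ^ j), qPoch_succ q q j, qPoch_succ q q r,
          qPoch_succ X, qPoch_succ (α * β * X * q ^ (j + 1)),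
          show α * β * X * q ^ j * q = α * β * X * q ^ (j + 1) by ring]
        have h1 := hn r
        have h2 := hn j
        have h3 := one_sub_pow_ne_zero hq r
        have h4 := one_sub_pow_ne_zero hq j
        field_simp
        ring)
      (by
        have := hn k
        simp only [Nat.sub_self, qPoch_zero, qPoch_succ q q k, pow_succ]
        field_simp)
    rw [ih] at step
    simp only [mul_assoc (1 - q * q ^ k), ← Finset.mul_sum] at step
    apply mul_left_cancel₀ hk1
    refine step.trans ?_
    rw [qPoch_succ q q k, qPoch_succ, qPoch_succ]
    have := hn k
    generalize 1 - q * q ^ k = y at *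
    field_simp

theorem sum_range_triangle (f : ℕ → ℕ → ℂ) (n : ℕ) :
    ∑ k ∈ range (n + 1), ∑ j ∈ range (k + 1), f j (k - j) =
      ∑ j ∈ range (n + 1), ∑ r ∈ range (n - j + 1), f j r := by
  induction n with
  | zero => simp
  | succ n ih =>
    rw [Finset.sum_range_succ, ih, Finset.sum_range_succ _ (n + 1), Finset.sum_range_succ _ (n + 1),
      ← add_assoc, ← Finset.sum_add_distrib]
    simp only [Nat.sub_self, zero_add, Finset.sum_range_one]
    congr 1
    refine Finset.sum_congr rfl fun j hj => ?_
    have : n + 1 - j = n - j + 1 := by have := Finset.mem_range.1 hj; omega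
    rw [this, Finset.sum_range_succ _ (n - j + 1)]

/-- The `q`-Pfaff–Saalschütz sum, read as an expansion of its closed form. -/
theorem saalschutz_expansion {q : ℂ} (hq : ∀ k : ℕ, 0 < k → q ^ k ≠ 1) (α β X D : ℂ)
    (hαβ : D = α * β * X) (k : ℕ) (hD : qPoch D q k ≠ 0) :
    qPoch (α * X) q k * qPoch (β * X) q k / (qPoch q q k * qPoch D q k) =
      ∑ j ∈ range (k + 1), qPoch α q j * qPoch β q j * X ^ j * qPoch X q (k - j) /
        (qPoch q q j * qPoch q q (k - j) * qPoch D q j) := by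
  have hs := sum_saalschutz hq α β X k
  rw [← div_div, ← hs, Finset.sum_div]
  refine Finset.sum_congr rfl fun j hj => ?_
  obtain ⟨r, rfl⟩ : ∃ r, k = j + r := ⟨k - j, by have := Finset.mem_range.1 hj; omega⟩
  rw [Nat.add_sub_cancel_left, ← hαβ]
  rw [qPoch_add D] at hD ⊢
  have h3 := left_ne_zero_of_mul hD
  have h4 := right_ne_zero_of_mul hD
  have h7 := qPoch_self_ne_zero hq j
  have h8 := qPoch_self_ne_zero hq r
  generalize qPoch (D * q ^ j) q r = Z at *
  field_simp

/-- Sears' transformation of a terminating balanced `₄φ₃` series. Here `z = q⁻ⁿ`, the numerator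
parameters are `z, A, αX, βX` and the denominator parameters are `D, E, F`; the balance condition
is expressed by `D = αβX`, `E = AXG`, `F = q^{1-n} / G`. -/
theorem sum_sears {q : ℂ} (hq0 : q ≠ 0) (hq : ∀ k : ℕ, 0 < k → q ^ k ≠ 1)
    (A α β X F G F' z D E : ℂ) (n : ℕ) (hz : z * q ^ n = 1) (hFG : F * G * q ^ n = q)
    (hFG' : F' * (X * G) * q ^ n = q) (hαβ : D = α * β * X) (hAX : E = A * X * G)
    (hD : qPoch D q n ≠ 0) (hE : qPoch E q n ≠ 0)
    (hG : qPoch G q n ≠ 0) (hXG : qPoch (X * G) q n ≠ 0) (hAG : qPoch (A * G) q n ≠ 0) :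
    ∑ k ∈ range (n + 1), qPoch z q k * q ^ k / qPoch F q k *
        (qPoch A q k * qPoch (α * X) q k * qPoch (β * X) q k) /
        (qPoch q q k * qPoch D q k * qPoch E q k) =
      qPoch (X * G) q n * qPoch (A * G) q n / (qPoch G q n * qPoch E q n) *
      ∑ k ∈ range (n + 1), qPoch z q k * q ^ k / qPoch F' q k *
        (qPoch A q k * qPoch α q k * qPoch β q k) /
        (qPoch q q k * qPoch D q k * qPoch (A * G) q k) := by
  have hn := qPoch_self_ne_zero hq
  -- the double sum obtained by expanding `(αX)_k (βX)_k / (D)_k` with `k = j + r`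
  set f : ℕ → ℕ → ℂ := fun j r =>
    (qPoch α q j * qPoch β q j * (X * G) ^ j * qPoch A q j /
      (qPoch D q j * qPoch q q j * qPoch E q j)) *
    (qPoch (A * q ^ j) q r * qPoch X q r * G ^ r * qPoch G q (n - j - r) /
      (qPoch q q r * qPoch q q (n - j - r) * qPoch (E * q ^ j) q r)) with hf
  have hl : ∀ k ∈ range (n + 1), qPoch z q k * q ^ k / qPoch F q k *
        (qPoch A q k * qPoch (α * X) q k * qPoch (β * X) q k) /
        (qPoch q q k * qPoch D q k * qPoch E q k) =
      qPoch q q n / qPoch G q n * ∑ j ∈ range (k + 1), f j (k - j) := by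
    intro k hk
    have hk : k ≤ n := by simpa [Nat.lt_succ_iff] using hk
    rw [qPoch_ratio_reverse F G z n k hk hq0 hFG hz hq hG]
    have hs := saalschutz_expansion hq α β X D hαβ k (qPoch_ne_zero_of_le hD hk)
    calc _ = qPoch q q n / qPoch G q n * (G ^ k * qPoch G q (n - k) * qPoch A q k /
          (qPoch q q (n - k) * qPoch E q k) *
          (qPoch (α * X) q k * qPoch (β * X) q k / (qPoch q q k * qPoch D q k))) := by
            ring
      _ = _ := by
        rw [hs, Finset.mul_sum (s := range (k + 1))]
        congr 1
        refine Finset.sum_congr rfl fun j hj => ?_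
        obtain ⟨r, rfl⟩ : ∃ r, k = j + r :=
          ⟨k - j, by have := Finset.mem_range.1 hj; omega⟩
        simp only [hf, Nat.add_sub_cancel_left, Nat.sub_sub, qPoch_add]
        ring
  rw [Finset.sum_congr rfl hl, ← Finset.mul_sum, sum_range_triangle, Finset.mul_sum,
    Finset.mul_sum]
  refine Finset.sum_congr rfl fun j hj => ?_
  have hj : j ≤ n := by simpa [Nat.lt_succ_iff] using hj
  rw [qPoch_ratio_reverse F' (X * G) z n j hj hq0 hFG' hz hq hXG]
  simp only [hf]
  rw [← Finset.mul_sum]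
  obtain ⟨s, rfl⟩ : ∃ s, n = j + s := ⟨n - j, by omega⟩
  simp only [Nat.add_sub_cancel_left]
  rw [qPoch_add E] at hE ⊢
  rw [qPoch_add (A * G)] at hAG ⊢
  have h5 := left_ne_zero_of_mul hE
  have h6 := right_ne_zero_of_mul hE
  have h7 := left_ne_zero_of_mul hAG
  rw [← saalschutz_expansion hq (A * q ^ j) X G (E * q ^ j) (by rw [hAX]; ring) s h6,
    show A * q ^ j * G = A * G * q ^ j by ring]
  have := hn s
  have := hn j
  have := qPoch_ne_zero_of_le hD hj
  generalize qPoch (E * q ^ j) q s = Y at *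
  generalize qPoch (A * G * q ^ j) q s = Z at *
  generalize qPoch (A * G) q j = W at *
  generalize qPoch (X * G) q (j + s) = U at *
  field_simp

/-! ### The terminating `q`-Watson sum -/

/-- The recurrence between the leading coefficients in `sum_watson`, with `N = q^n`. -/
theorem watson_top_identity {q p N : ℂ} (hq : q ≠ 0) (hN : N ≠ 0) (h1 : 1 - q * N ≠ 0)
    (h2 : 1 - q * N ^ 2 ≠ 0) (h3 : 1 - q * p * N ^ 2 ≠ 0) :
    (1 - q * N ^ 2) * (1 - q * p * N ^ 2) * (q * (1 - 1 / (q * N)) /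
      ((1 - 1 / (q * N ^ 2)) * (1 - q * N) * (1 - q * p * N ^ 2))) = q * N := by
  have h4 : 1 - 1 / (q * N ^ 2) = -(1 - q * N ^ 2) / (q * N ^ 2) := by field_simp; ring
  have h5 : 1 - 1 / (q * N) = -(1 - q * N) / (q * N) := by field_simp; ring
  rw [h4, h5]
  generalize 1 - q * p * N ^ 2 = Z at *
  generalize 1 - q * N ^ 2 = Y at *
  generalize 1 - q * N = X at *
  field_simp

/-- The recurrence between the coefficients in `sum_watson`, with `N = q^n` and `Q = q^j`, after
division by the coefficient with index `j`. -/
theorem watson_identity {q p N Q : ℂ} (hq : q ≠ 0) (hN : N ≠ 0) (hQ : Q ≠ 0)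
    (h1 : 1 - q * Q ≠ 0) (h2 : 1 - q * N ^ 2 ≠ 0) (h3 : 1 - q * p * Q ^ 2 ≠ 0)
    (h4 : N ^ 2 - Q ≠ 0) :
    (1 - q * N ^ 2) * (1 - q * p * N ^ 2) * (q * (1 - Q / (q * N ^ 2)) /
      ((1 - 1 / (q * N ^ 2)) * (1 - q * Q) * (1 - q * p * Q ^ 2))) =
    q * N ^ 2 / Q + (1 - N ^ 2 / Q) * (1 - p * (q ^ 2 * N ^ 2 * Q)) *
      (q * (1 - Q ^ 2 / N ^ 2) / ((1 - q * Q) * (1 - Q / N ^ 2) * (1 - q * p * Q ^ 2))) := by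
  have h5 : 1 - 1 / (q * N ^ 2) = -(1 - q * N ^ 2) / (q * N ^ 2) := by field_simp; ring
  have h6 : 1 - Q / N ^ 2 = (N ^ 2 - Q) / N ^ 2 := by field_simp
  have h7 : 1 - N ^ 2 / Q = -(N ^ 2 - Q) / Q := by field_simp; ring
  rw [h5, h6, h7]
  have e1 : (1 - q * N ^ 2) * (1 - q * p * N ^ 2) * (q * (1 - Q / (q * N ^ 2)) /
      (-(1 - q * N ^ 2) / (q * N ^ 2) * (1 - q * Q) * (1 - q * p * Q ^ 2))) =
      -(1 - q * p * N ^ 2) * q * (q * N ^ 2 - Q) / ((1 - q * Q) * (1 - q * p * Q ^ 2)) := by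
    generalize 1 - q * p * Q ^ 2 = Z at *
    generalize 1 - q * p * N ^ 2 = W at *
    generalize 1 - q * N ^ 2 = Y at *
    generalize 1 - q * Q = X at *
    field_simp
  have e2 : -(N ^ 2 - Q) / Q * (1 - p * (q ^ 2 * N ^ 2 * Q)) *
      (q * (1 - Q ^ 2 / N ^ 2) / ((1 - q * Q) * ((N ^ 2 - Q) / N ^ 2) * (1 - q * p * Q ^ 2))) =
      -(1 - p * (q ^ 2 * N ^ 2 * Q)) * q * (N ^ 2 - Q ^ 2) /
        (Q * ((1 - q * Q) * (1 - q * p * Q ^ 2))) := by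
    generalize 1 - q * p * Q ^ 2 = Z at *
    generalize 1 - p * (q ^ 2 * N ^ 2 * Q) = W at *
    generalize N ^ 2 - Q = Y at *
    generalize 1 - q * Q = X at *
    field_simp
  rw [e1, e2, div_add_div _ _ hQ (by positivity), div_eq_div_iff (by positivity) (by positivity)]
  ring

/-- The factors of `(q⁻ⁿ; q)_k` do not vanish for `k ≤ n`. -/
theorem qPoch_neg_pow_ne_zero {q y : ℂ} (hq : ∀ k : ℕ, 0 < k → q ^ k ≠ 1) {n k : ℕ}
    (hy : y * q ^ n = 1) (hk : k ≤ n) : qPoch y q k ≠ 0 := by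
  rw [qPoch_ne_zero_iff]
  intro i hi h
  obtain ⟨r, rfl⟩ : ∃ r, n = i + (r + 1) := ⟨n - (i + 1), by omega⟩
  refine hq (r + 1) r.succ_pos ?_
  linear_combination hy + h * q ^ (r + 1)

/-- Andrews' terminating `q`-analogue of Watson's `₃F₂` sum, as an identity in the two parameters
`u` and `v`. Here `z = q⁻ⁿ`, and the pairs of parameters `±z` and `±√(qp)` of the `₄φ₃` series are
written as shifted factorials with base `q²`. -/
theorem sum_watson {q : ℂ} (hq0 : q ≠ 0) (hq : ∀ k : ℕ, 0 < k → q ^ k ≠ 1) (u v p z : ℂ)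
    (hp : p = u * v) (n : ℕ) (hz : z * q ^ n = 1) (hpn : qPoch (q * p) (q ^ 2) n ≠ 0) :
    ∑ k ∈ range (n + 1), qPoch (z ^ 2) (q ^ 2) k * q ^ k /
        (qPoch q q k * qPoch (z ^ 2) q k * qPoch (q * p) (q ^ 2) k) *
        (qPoch u q k * qPoch v q k) =
      qPoch (q * u) (q ^ 2) n * qPoch (q * v) (q ^ 2) n /
        (qPoch q (q ^ 2) n * qPoch (q * p) (q ^ 2) n) := by
  induction n generalizing z with
  | zero => simp [qPoch_zero]
  | succ n ih =>
    have ih := ih (z * q) (by rw [← hz]; ring) (qPoch_ne_zero_of_le hpn n.le_succ)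
    have hn := qPoch_self_ne_zero hq
    have hN : q ^ n ≠ 0 := pow_ne_zero _ hq0
    have hpk : ∀ j ≤ n, 1 - q * p * (q ^ j) ^ 2 ≠ 0 := by
      intro j hj
      have := qPoch_ne_zero_iff.1 hpn j (by omega)
      rwa [← pow_mul, mul_comm 2 j, pow_mul] at this
    have hN2 : 1 - q * (q ^ n) ^ 2 ≠ 0 := by
      rw [← pow_mul]; exact one_sub_pow_ne_zero hq _
    have hz2 : z ^ 2 = 1 / (q ^ 2 * (q ^ n) ^ 2) := by
      field_simp
      rw [show z ^ 2 * q ^ 2 * (q ^ n) ^ 2 = (z * q ^ (n + 1)) ^ 2 by ring, hz, one_pow]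
    have hzq : z ^ 2 * q ^ 2 = 1 / (q ^ n) ^ 2 := by rw [hz2]; field_simp
    have hzq' : (z * q) ^ 2 = 1 / (q ^ n) ^ 2 := by rw [mul_pow, hzq]
    set E : ℕ → ℂ := fun k => qPoch ((z * q) ^ 2) (q ^ 2) k * q ^ k /
        (qPoch q q k * qPoch ((z * q) ^ 2) q k * qPoch (q * p) (q ^ 2) k) with hE
    set E' : ℕ → ℂ := fun k => qPoch (z ^ 2) (q ^ 2) k * q ^ k /
        (qPoch q q k * qPoch (z ^ 2) q k * qPoch (q * p) (q ^ 2) k) with hE'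
    have hYq : z ^ 2 * q ^ (2 * n + 2) = 1 := by
      rw [show z ^ 2 * q ^ (2 * n + 2) = (z * q ^ (n + 1)) ^ 2 by ring, hz, one_pow]
    -- consecutive coefficients of the expansions for `n` and `n + 1`
    have hE'E : ∀ j ≤ n, E' (j + 1) = E j * (q * (1 - q ^ j / (q * (q ^ n) ^ 2)) /
        ((1 - 1 / (q * (q ^ n) ^ 2)) * (1 - q * q ^ j) * (1 - q * p * (q ^ j) ^ 2))) := by
      intro j hj
      have a1 : qPoch (z ^ 2) (q ^ 2) (j + 1) = (1 - z ^ 2) * qPoch ((z * q) ^ 2) (q ^ 2) j := by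
        rw [qPoch_succ_left, mul_pow]
      have a2 : qPoch (z ^ 2) q (j + 1) * (1 - z ^ 2 * q ^ (j + 1)) =
          (1 - z ^ 2) * (1 - z ^ 2 * q) * qPoch ((z * q) ^ 2) q j := by
        rw [← qPoch_succ, qPoch_succ_left, qPoch_succ_left,
          show z ^ 2 * q * q = (z * q) ^ 2 by ring]
        ring
      have n1 : qPoch (z ^ 2) q (j + 2) ≠ 0 := qPoch_neg_pow_ne_zero hq hYq (by omega)
      rw [qPoch_succ] at n1
      have n2 := left_ne_zero_of_mul n1
      have n3 := right_ne_zero_of_mul n1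
      have n4 : (1 - z ^ 2) * (1 - z ^ 2 * q) * qPoch ((z * q) ^ 2) q j ≠ 0 := by
        rw [← a2]; exact mul_ne_zero n2 n3
      have n5 := right_ne_zero_of_mul n4
      have n6 := left_ne_zero_of_mul (left_ne_zero_of_mul n4)
      have n7 := right_ne_zero_of_mul (left_ne_zero_of_mul n4)
      have a3 : qPoch (z ^ 2) q (j + 1) = (1 - z ^ 2) * (1 - z ^ 2 * q) *
          qPoch ((z * q) ^ 2) q j / (1 - z ^ 2 * q ^ (j + 1)) := by
        rw [eq_div_iff n3, a2]
      have b1 : 1 - q ^ j / (q * (q ^ n) ^ 2) = 1 - z ^ 2 * q ^ (j + 1) := by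
        rw [hz2]; field_simp; ring
      have b2 : 1 - 1 / (q * (q ^ n) ^ 2) = 1 - z ^ 2 * q := by rw [hz2]; field_simp
      have b3 : qPoch (q * p) (q ^ 2) (j + 1) =
          qPoch (q * p) (q ^ 2) j * (1 - q * p * (q ^ j) ^ 2) := by
        rw [qPoch_succ]; ring
      simp only [hE, hE', b1, b2, a1, a3, b3, qPoch_succ q, pow_succ q j]
      generalize qPoch ((z * q) ^ 2) (q ^ 2) j = x8 at *
      have := hn j
      have := one_sub_pow_ne_zero hq j
      have := hpk j hj
      have := qPoch_ne_zero_of_le hpn (show j ≤ n + 1 by omega)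
      generalize 1 - q * p * (q ^ j) ^ 2 = x1 at *
      generalize 1 - q * q ^ j = x2 at *
      generalize 1 - z ^ 2 * q ^ (j + 1) = x3 at *
      generalize 1 - z ^ 2 * q = x4 at *
      generalize 1 - z ^ 2 = x5 at *
      generalize qPoch ((z * q) ^ 2) q j = x6 at *
      generalize qPoch (q * p) (q ^ 2) j = x7 at *
      clear hz2 hzq hzq' hYq
      field_simp
    have hEE : ∀ j < n, E (j + 1) = E j * (q * (1 - (q ^ j) ^ 2 / (q ^ n) ^ 2) /
        ((1 - q * q ^ j) * (1 - q ^ j / (q ^ n) ^ 2) * (1 - q * p * (q ^ j) ^ 2))) := by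
      intro j hj
      have b1 : 1 - (z * q) ^ 2 * (q ^ 2) ^ j = 1 - (q ^ j) ^ 2 / (q ^ n) ^ 2 := by
        rw [hzq']; ring
      have b2 : 1 - (z * q) ^ 2 * q ^ j = 1 - q ^ j / (q ^ n) ^ 2 := by rw [hzq']; ring
      have b3 : 1 - q * p * (q ^ 2) ^ j = 1 - q * p * (q ^ j) ^ 2 := by ring
      simp only [hE, qPoch_succ, b1, b2, b3, pow_succ q j]
      generalize 1 - q ^ j / (q ^ n) ^ 2 = x1
      generalize 1 - q * p * (q ^ j) ^ 2 = x2
      generalize 1 - q * q ^ j = x3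
      ring
    have hNQ : ∀ j < n, (q ^ n) ^ 2 - q ^ j ≠ 0 := by
      intro j hj h
      obtain ⟨r, rfl⟩ : ∃ r, n = j + 1 + r := ⟨n - (j + 1), by omega⟩
      refine hq (j + 2 + 2 * r) (by omega) ?_
      apply mul_left_cancel₀ (pow_ne_zero j hq0)
      linear_combination h
    -- the closed form gains the factor `(1 - u q^(2n+1))(1 - v q^(2n+1))`, which is
    -- `q^(2n+1-j) (1 - u q^j)(1 - v q^j)` plus a remainder depending only on `p = uv`
    have step := sum_mul_of_basis_step (fun j => qPoch u q j * qPoch v q j)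
      (fun j => q * (q ^ n) ^ 2 / q ^ j) (fun j => (1 - u * q ^ j) * (1 - v * q ^ j))
      (fun j => (1 - q * (q ^ n) ^ 2 / q ^ j) * (1 - p * (q * (q ^ n) ^ 2 * q ^ j)))
      E (fun j => (1 - q * (q ^ n) ^ 2) * (1 - q * p * (q ^ n) ^ 2) * E' j)
      ((1 - q * u * (q ^ n) ^ 2) * (1 - q * v * (q ^ n) ^ 2)) n
      (fun j => by simp only [qPoch_succ]; ring)
      (fun j _ => by
        have : q ^ j ≠ 0 := pow_ne_zero _ hq0
        rw [hp]
        field_simp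
        ring)
      (by simp [hE, hE', qPoch_zero]; left; ring)
      (fun j hj => by
        have hQ : q ^ j ≠ 0 := pow_ne_zero _ hq0
        have key := watson_identity (p := p) hq0 hN hQ (one_sub_pow_ne_zero hq j) hN2
          (hpk j hj.le) (hNQ j hj)
        rw [hE'E j hj.le, hEE j hj,
          show q * (q ^ n) ^ 2 / q ^ (j + 1) = (q ^ n) ^ 2 / q ^ j by field_simp; ring,
          show q * (q ^ n) ^ 2 * q ^ (j + 1) = q ^ 2 * (q ^ n) ^ 2 * q ^ j by ring]
        linear_combination E j * key)
      (by
        have key := watson_top_identity (p := p) hq0 hN (one_sub_pow_ne_zero hq n) hN2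
          (hpk n le_rfl)
        have e1 : q ^ n / (q * (q ^ n) ^ 2) = 1 / (q * q ^ n) := by field_simp
        have e2 : q * (q ^ n) ^ 2 / q ^ n = q * q ^ n := by field_simp
        rw [hE'E n le_rfl, e1, e2]
        linear_combination E n * key)
    rw [ih] at step
    simp only [mul_assoc ((1 - q * (q ^ n) ^ 2) * (1 - q * p * (q ^ n) ^ 2)),
      ← Finset.mul_sum] at step
    have hc := mul_ne_zero hN2 (hpk n le_rfl)
    apply mul_left_cancel₀ hc
    refine step.trans ?_
    have hq2 : qPoch q (q ^ 2) n ≠ 0 := by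
      rw [qPoch_ne_zero_iff]
      intro k _
      rw [← pow_mul]
      exact one_sub_pow_ne_zero hq _
    have hp2 := qPoch_ne_zero_of_le hpn n.le_succ
    simp only [qPoch_succ _ (q ^ 2), ← pow_mul, mul_comm 2 n]
    have hc1 := left_ne_zero_of_mul hc
    have hc2 := right_ne_zero_of_mul hc
    simp only [← pow_mul] at hc1 hc2
    generalize 1 - q * p * q ^ (n * 2) = x1 at *
    generalize 1 - q * q ^ (n * 2) = x2 at *
    generalize qPoch (q * p) (q ^ 2) n = x3 at *
    field_simp

/-! ### A very-well-poised sum -/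

/-- The telescoping step of `sum_vwp_partial`, with `S = q^s` and `R = q^r`. -/
theorem vwp_step_identity {q d t b S R : ℂ} (hbt : b * t = 1) (h1 : 1 - q * S ≠ 0)
    (h2 : 1 - q * R ≠ 0) (h3 : 1 - d ^ 2 * (q ^ 2 * S ^ 2 * R) ≠ 0) :
    -(q * R) * (1 - d ^ 2 * t * S) * (1 - d * S) / (1 - q * R) +
      ((1 - d * (S * q * R)) * (1 - q * (S * q * R)) * ((1 - d ^ 2 * q * S ^ 2) *
        (1 - d ^ 2 * t * (S * q * R)) /
        ((1 - q * S) * (1 - q * R) * (1 - d ^ 2 * (q ^ 2 * S ^ 2 * R)))) -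
      (1 - d * t * (S * q * R)) * ((1 - d ^ 2 * q * S ^ 2) / (1 - q * S))) =
    R * (d * t) * (q * S) * (1 - d ^ 2 * S) * (1 - b * (q * S)) * (1 - d * (q * S)) /
      ((1 - q * S) * (1 - d ^ 2 * (q ^ 2 * S ^ 2 * R))) := by
  have e : R * (d * t) * (q * S) * (1 - d ^ 2 * S) * (1 - b * (q * S)) * (1 - d * (q * S)) =
    R * d * (q * S) * (1 - d ^ 2 * S) * (t - q * S) * (1 - d * (q * S)) := by
    linear_combination -R * d * (q * S) * (1 - d ^ 2 * S) * (q * S) * (1 - d * (q * S)) * hbt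
  rw [e]
  generalize hx1 : 1 - q * S = x1 at *
  generalize hx2 : 1 - q * R = x2 at *
  generalize hx3 : 1 - d ^ 2 * (q ^ 2 * S ^ 2 * R) = x3 at *
  field_simp
  subst hx1 hx2 hx3
  ring

/-- The `i`-th term of the terminating very-well-poised `₆φ₅` series with parameters
`a, b, d, q^{-N}`, where `d² = aq` and `t = 1 / b`, divided by `(q; q)_N (aq; q)_N` and multiplied
by `(1 - a) (aq / b; q)_N`. In this normalization it stays defined when factors of
`(aq / b; q)_N` vanish. -/
noncomputable def vwpTerm (q a b t d : ℂ) (N i : ℕ) : ℂ :=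
  (-(d * t)) ^ i * q ^ i.choose 2 * (1 - a * q ^ (2 * i)) * qPoch a q i * qPoch b q i *
      qPoch (d ^ 2 * t * q ^ i) q (N - i) /
    (qPoch q q i * qPoch q q (N - i) * qPoch (d ^ 2) q (N + i))

/-- The factors `1 - d² q^{2k}` of `(d²; q)_{2N}` are divisible by the factors of `(d; q)_N`. -/
theorem qPoch_ne_zero_of_sq {d q : ℂ} {N : ℕ} (h : qPoch (d ^ 2) q (2 * N) ≠ 0) :
    qPoch d q N ≠ 0 := by
  rw [qPoch_ne_zero_iff] at h ⊢
  intro k hk h0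
  refine h (2 * k) (by omega) ?_
  linear_combination (1 + d * q ^ k) * h0

/-- Partial sums of the recurrence in `N` for the sum of the `vwpTerm q a b t d N i`; the closed form
on the right is the Wilf–Zeilberger certificate of `sum_vwp`. -/
theorem sum_vwp_partial {q : ℂ} (hq : ∀ k : ℕ, 0 < k → q ^ k ≠ 1)
    (a b t d : ℂ) (had : a * q = d ^ 2) (hbt : b * t = 1) (N s : ℕ) (hs : s ≤ N)
    (hN : qPoch (d ^ 2) q (2 * (N + 1)) ≠ 0) :
    ∑ i ∈ range (s + 1), ((1 - d * q ^ N) * (1 - q * q ^ N) * vwpTerm q a b t d (N + 1) i -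
        (1 - d * t * q ^ N) * vwpTerm q a b t d N i) =
      -q ^ (N - s) * (-(d * t)) ^ (s + 1) * q ^ (s + 1).choose 2 * qPoch a q (s + 1) *
        qPoch b q (s + 1) * qPoch (d ^ 2 * t * q ^ s) q (N - s) * (1 - d * q ^ s) /
        (qPoch q q s * qPoch q q (N - s) * qPoch (d ^ 2) q (N + s + 1)) := by
  have hn := qPoch_self_ne_zero hq
  induction s with
  | zero =>
    have h1 := qPoch_ne_zero_of_le hN (show N + 1 ≤ _ by omega)
    rw [qPoch_succ] at h1
    have h2 := left_ne_zero_of_mul h1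
    have h3 := right_ne_zero_of_mul h1
    have h4 := one_sub_pow_ne_zero hq N
    have h5 := hn N
    simp only [vwpTerm, zero_add, Finset.sum_range_one, qPoch_zero, qPoch_succ, Nat.sub_zero,
      add_zero, pow_zero, mul_zero, pow_one, mul_one, one_mul,
      Nat.choose_succ_self, Nat.choose_zero_succ]
    generalize qPoch (d ^ 2 * t) q N = Z
    generalize qPoch (d ^ 2) q N = W at *
    generalize hx2 : 1 - q * q ^ N = x2 at *
    generalize hx3 : 1 - d ^ 2 * q ^ N = x3 at *
    field_simp
    subst hx2 hx3
    linear_combination (q ^ N * d - q ^ N * d ^ 2) * (1 - a) * Z * hbt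
  | succ s ih =>
    obtain ⟨r, rfl⟩ : ∃ r, N = s + 1 + r := ⟨N - (s + 1), by omega⟩
    rw [Finset.sum_range_succ, ih (by omega)]
    have e1 : s + 1 + r - s = r + 1 := by omega
    have e2 : s + 1 + r - (s + 1) = r := by omega
    have e3 : s + 1 + r + 1 - (s + 1) = r + 1 := by omega
    have e4 : s + 1 + r + (s + 1) = s + 1 + r + s + 1 := by omega
    have e5 : s + 1 + r + 1 + (s + 1) = s + 1 + r + s + 1 + 1 := by omega
    have h1 := qPoch_ne_zero_of_le hN (show s + 1 + r + s + 1 + 1 ≤ _ by omega)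
    rw [qPoch_succ] at h1
    have h2 := left_ne_zero_of_mul h1
    have h3 := right_ne_zero_of_mul h1
    have key := vwp_step_identity (q := q) (d := d) (t := t) (b := b) (S := q ^ s) (R := q ^ r)
      hbt (one_sub_pow_ne_zero hq s) (one_sub_pow_ne_zero hq r)
      (by rw [show q ^ 2 * (q ^ s) ^ 2 * q ^ r = q ^ (s + 1 + r + s + 1) by ring]; exact h3)
    have c1 : (s + 1).choose 2 = s + s.choose 2 := by
      rw [Nat.choose_succ_succ' s 1, Nat.choose_one_right]
    have c2 : (s + 1 + 1).choose 2 = s + 1 + (s + 1).choose 2 := by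
      rw [Nat.choose_succ_succ' (s + 1) 1, Nat.choose_one_right]
    have a1 : 1 - a * q ^ (2 * (s + 1)) = 1 - d ^ 2 * q * (q ^ s) ^ 2 := by
      rw [← had]; ring
    have a2 : 1 - a * q ^ (s + 1) = 1 - d ^ 2 * q ^ s := by rw [← had]; ring
    have a3 : 1 - d ^ 2 * t * q ^ (s + 1) * q ^ r = 1 - d ^ 2 * t * (q ^ s * q * q ^ r) := by ring
    have a4 : 1 - d ^ 2 * q ^ (s + 1 + r + s + 1) =
      1 - d ^ 2 * (q ^ 2 * (q ^ s) ^ 2 * q ^ r) := by ring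
    have a5 : q ^ (s + 1 + r) = q ^ s * q * q ^ r := by ring
    have a6 : q ^ (r + 1) = q * q ^ r := by ring
    have a7 : q ^ (s + 1) = q * q ^ s := by ring
    simp only [vwpTerm, e1, e2, e3, e4, e5, c2]
    rw [qPoch_succ_left (d ^ 2 * t * q ^ s), show d ^ 2 * t * q ^ s * q = d ^ 2 * t * q ^ (s + 1) by
      ring]
    rw [qPoch_succ (d ^ 2 * t * q ^ (s + 1)), qPoch_succ q q s, qPoch_succ q q r,
      qPoch_succ (d ^ 2) q (s + 1 + r + s + 1), qPoch_succ a q (s + 1), qPoch_succ b q (s + 1),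
      a1, a2, a3, a4, a5, a6, pow_succ _ (s + 1), pow_add q (s + 1), a7]
    generalize qPoch (d ^ 2 * t * (q * q ^ s)) q r = Z1
    generalize qPoch (d ^ 2) q (s + 1 + r + s + 1) = Z2
    generalize 1 - d ^ 2 * (q ^ 2 * (q ^ s) ^ 2 * q ^ r) = x1 at *
    generalize 1 - q * q ^ s = x2 at *
    generalize 1 - q * q ^ r = x3 at *
    linear_combination (-(d * t)) ^ (s + 1) * q ^ (s + 1).choose 2 * qPoch a q (s + 1) *
      qPoch b q (s + 1) * Z1 / (qPoch q q s * qPoch q q r * Z2) * key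

/-- The terminating `₆φ₅` sum in the case where one parameter is the square root of `aq`. -/
theorem sum_vwp {q : ℂ} (hq : ∀ k : ℕ, 0 < k → q ^ k ≠ 1)
    (a b t d : ℂ) (had : a * q = d ^ 2) (hbt : b * t = 1) (N : ℕ)
    (hN : qPoch (d ^ 2) q (2 * N) ≠ 0) :
    ∑ i ∈ range (N + 1), vwpTerm q a b t d N i =
      (1 - a) * qPoch (d * t) q N / (qPoch d q N * qPoch q q N) := by
  have hn := qPoch_self_ne_zero hq
  induction N with
  | zero => simp [vwpTerm, qPoch_zero]
  | succ N ih =>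
    have hp := sum_vwp_partial hq a b t d had hbt N N le_rfl hN
    rw [Finset.sum_sub_distrib, ← Finset.mul_sum, ← Finset.mul_sum,
      ih (qPoch_ne_zero_of_le hN (by omega))] at hp
    have hd := qPoch_ne_zero_of_sq hN
    rw [qPoch_succ] at hd
    have hd1 := left_ne_zero_of_mul hd
    have hd2 := right_ne_zero_of_mul hd
    have h3 := one_sub_pow_ne_zero hq N
    have h1 := qPoch_ne_zero_of_le hN (show N + N + 1 + 1 ≤ _ by omega)
    rw [qPoch_succ] at h1
    have h5 := left_ne_zero_of_mul h1
    have h6 := right_ne_zero_of_mul h1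
    -- the term of index `N + 1` cancels the telescoped sum of the others
    have hlast : (1 - d * q ^ N) * (1 - q * q ^ N) * vwpTerm q a b t d (N + 1) (N + 1) =
        q ^ (N - N) * (-(d * t)) ^ (N + 1) * q ^ (N + 1).choose 2 * qPoch a q (N + 1) *
        qPoch b q (N + 1) * qPoch (d ^ 2 * t * q ^ N) q (N - N) * (1 - d * q ^ N) /
        (qPoch q q N * qPoch q q (N - N) * qPoch (d ^ 2) q (N + N + 1)) := by
      have a1 : 1 - a * q ^ (2 * (N + 1)) = 1 - d ^ 2 * q ^ (N + N + 1) := by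
        rw [← had]; ring
      simp only [vwpTerm, Nat.sub_self, qPoch_zero, qPoch_succ q q N,
        show N + 1 + (N + 1) = N + N + 1 + 1 by omega, qPoch_succ (d ^ 2) q (N + N + 1), a1]
      have := hn N
      generalize 1 - d ^ 2 * q ^ (N + N + 1) = x1 at *
      generalize 1 - q * q ^ N = x2 at *
      generalize qPoch (d ^ 2) q (N + N + 1) = x3 at *
      field_simp
    rw [Finset.sum_range_succ]
    apply mul_left_cancel₀ (mul_ne_zero hd2 h3)
    rw [mul_add, hlast]
    have e : (1 - d * q ^ N) * (1 - q * q ^ N) * ((1 - a) * qPoch (d * t) q (N + 1) /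
        (qPoch d q (N + 1) * qPoch q q (N + 1))) =
        (1 - d * t * q ^ N) * ((1 - a) * qPoch (d * t) q N / (qPoch d q N * qPoch q q N)) := by
      simp only [qPoch_succ]
      have := hn N
      generalize 1 - q * q ^ N = x2 at *
      generalize 1 - d * q ^ N = x3 at *
      field_simp
    rw [e]
    linear_combination hp

/-! ### Expansion by the `q`-Watson sum -/

theorem qPoch_sq (x q : ℂ) (n : ℕ) :
    qPoch (x ^ 2) (q ^ 2) n = qPoch x q n * qPoch (-x) q n := by
  simp only [qPoch, ← Finset.prod_mul_distrib]
  exact Finset.prod_congr rfl fun k _ => by ring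

/-- The factors of the inner summand with index `j` on the right side of the theorem that do not
depend on `u = q^{ℓ-i} a` and `v = q^{1-ℓ+i} a / c²`, where `b = q^{-m}`, `y = q^{-m-n}`, `z = q⁻ⁿ`,
`z' = q^{-m-2n}` and `p = uv`. The products over `±y` and `±√(qp)` are written with base `q²`. -/
noncomputable def watsonCoeff (q p b y z z' : ℂ) (j : ℕ) : ℂ :=
  (-z) ^ j * q ^ (j + 1).choose 2 * qPoch b q j * qPoch (y ^ 2) (q ^ 2) j /
    (qPoch q q j * qPoch (q * p) (q ^ 2) j * qPoch z' q j * qPoch (y ^ 2 / q * q ^ j) q j)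

/-- The sum over `j` as a single series in the products `(u; q)_k (v; q)_k`. Expanding each term with
`sum_watson` leaves, as coefficient of `(u; q)_s (v; q)_s`, a sum over `j ≤ s` to which `sum_vwp`
applies with leading parameter `y² / q` and `d = y`. -/
theorem sum_watson_expansion {q : ℂ} (hq0 : q ≠ 0) (hq : ∀ k : ℕ, 0 < k → q ^ k ≠ 1)
    (u v p b y z z' : ℂ) (hp : p = u * v) (m n : ℕ) (hb : b * q ^ m = 1)
    (hy : y * q ^ (m + n) = 1) (hz : z * q ^ n = 1) (hz' : z' * q ^ (m + n + n) = 1)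
    (hpM : qPoch (q * p) (q ^ 2) (m + n) ≠ 0) :
    ∑ j ∈ range (m + 1), watsonCoeff q p b y z z' j * (qPoch u q j * qPoch v q j) *
        (qPoch (q * (u * q ^ j)) (q ^ 2) (m + n - j) * qPoch (q * (v * q ^ j)) (q ^ 2) (m + n - j) /
        (qPoch q (q ^ 2) (m + n - j) * qPoch (q * p * (q ^ 2) ^ j) (q ^ 2) (m + n - j))) =
      ∑ k ∈ range (n + 1), qPoch z q k * q ^ k * qPoch (-y) q k /
        (qPoch q q k * qPoch z' q k * qPoch (q * p) (q ^ 2) k) * (qPoch u q k * qPoch v q k) := by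
  have hn := qPoch_self_ne_zero hq
  have hyt : y * q ^ m = z := by
    apply mul_right_cancel₀ (pow_ne_zero n hq0)
    rw [hz, ← hy]; ring
  have hyt' : y ^ 2 * q ^ m = z' := by
    apply mul_right_cancel₀ (pow_ne_zero (m + n + n) hq0)
    rw [hz', show y ^ 2 * q ^ m * q ^ (m + n + n) = (y * q ^ (m + n)) ^ 2 by ring, hy, one_pow]
  set M := m + n with hM
  have hy2 : y ^ 2 * q ^ (2 * M) = 1 := by
    rw [show y ^ 2 * q ^ (2 * M) = (y * q ^ M) ^ 2 by ring, hy, one_pow]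
  have ha : y ^ 2 / q * q ^ (2 * M + 1) = 1 := by
    rw [← hy2]; field_simp; ring
  set f : ℕ → ℕ → ℂ := fun j k =>
    watsonCoeff q p b y z z' j * (qPoch u q (j + k) * qPoch v q (j + k)) *
    (qPoch ((y * q ^ j) ^ 2) (q ^ 2) k * q ^ k /
        (qPoch q q k * qPoch ((y * q ^ j) ^ 2) q k * qPoch (q * p * (q ^ 2) ^ j) (q ^ 2) k)) with hf
  -- both sums extend to `range (M + 1)`, as `(b; q)_j = 0` for `j > m` and `(z; q)_k = 0` for `k > n`
  refine (Finset.sum_subset (s₂ := range (M + 1)) (Finset.range_subset_range.2 (by omega))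
    (fun k _ hk => ?_)).trans (Eq.trans ?_ (Finset.sum_subset (s₂ := range (M + 1))
      (Finset.range_subset_range.2 (by omega)) (fun k _ hk => ?_)).symm)
  · have : qPoch b q k = 0 := qPoch_eq_zero (k := m) (by simpa using hk) hb
    simp [this, watsonCoeff]
  swap
  · have : qPoch z q k = 0 := qPoch_eq_zero (k := n) (by simpa using hk) hz
    simp [this]
  have hl : ∀ j ∈ range (M + 1), watsonCoeff q p b y z z' j * (qPoch u q j * qPoch v q j) *
        (qPoch (q * (u * q ^ j)) (q ^ 2) (M - j) * qPoch (q * (v * q ^ j)) (q ^ 2) (M - j) /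
        (qPoch q (q ^ 2) (M - j) * qPoch (q * p * (q ^ 2) ^ j) (q ^ 2) (M - j))) =
      ∑ k ∈ range (M - j + 1), f j k := by
    intro j hj
    obtain ⟨r, hr⟩ : ∃ r, M = j + r := ⟨M - j, by have := Finset.mem_range.1 hj; omega⟩
    rw [hr, Nat.add_sub_cancel_left]
    rw [hr, qPoch_add] at hpM
    have e : q * (p * (q ^ 2) ^ j) = q * p * (q ^ 2) ^ j := by ring
    have hw := sum_watson hq0 hq (u * q ^ j) (v * q ^ j) (p * (q ^ 2) ^ j) (y * q ^ j)
      (by rw [hp]; ring) r (by rw [← hy, hr]; ring) (by rw [e]; exact right_ne_zero_of_mul hpM)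
    rw [e] at hw
    rw [← hw, Finset.mul_sum]
    refine Finset.sum_congr rfl fun k _ => ?_
    simp only [hf, qPoch_add u, qPoch_add v]
    ring
  rw [Finset.sum_congr rfl hl, ← sum_range_triangle]
  refine Finset.sum_congr rfl fun s hs => ?_
  have hs : s ≤ M := by simpa [Nat.lt_succ_iff] using hs
  have hv := sum_vwp hq (y ^ 2 / q) b (q ^ m) y (by field_simp) hb s
    (qPoch_neg_pow_ne_zero hq hy2 (by omega))
  rw [hyt] at hv
  have hz's : qPoch z' q s ≠ 0 := qPoch_neg_pow_ne_zero hq hz' (by omega)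
  have hps := qPoch_ne_zero_of_le hpM hs
  have ha1 : 1 - y ^ 2 / q ≠ 0 := by
    have := qPoch_neg_pow_ne_zero hq ha (show 1 ≤ _ by omega)
    simpa [qPoch] using this
  have hys : qPoch y q s ≠ 0 := qPoch_neg_pow_ne_zero hq hy hs
  calc _ = ∑ j ∈ range (s + 1), qPoch u q s * qPoch v q s * q ^ s * qPoch (y ^ 2) (q ^ 2) s /
        (qPoch (q * p) (q ^ 2) s * (1 - y ^ 2 / q) * qPoch z' q s) *
        vwpTerm q (y ^ 2 / q) b (q ^ m) y s j := by
        refine Finset.sum_congr rfl fun j hj => ?_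
        obtain ⟨r, rfl⟩ : ∃ r, s = j + r := ⟨s - j, by have := Finset.mem_range.1 hj; omega⟩
        -- the factor `1 - y² q^(2j-1)` of the very-well-poised series is the one that is
        -- missing between `(y² / q; q)_{2j}` and `(y² q^{2j}; q)_r`
        have hA := qPoch_neg_pow_ne_zero hq ha (show j + j + 1 + r ≤ _ by omega)
        have hA' : (1 - y ^ 2 / q) * qPoch (y ^ 2) q (j + r + j) =
            qPoch (y ^ 2 / q) q (j + j + 1 + r) := by
          rw [show j + j + 1 + r = j + r + j + 1 by omega, qPoch_succ_left, div_mul_cancel₀ _ hq0]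
        have e1 : y ^ 2 / q * q ^ (j + j + 1) = (y * q ^ j) ^ 2 := by field_simp; ring
        have hE : qPoch (y ^ 2 / q) q (j + j + 1 + r) = qPoch (y ^ 2 / q) q j *
            qPoch (y ^ 2 / q * q ^ j) q j * (1 - y ^ 2 / q * q ^ (j + j)) *
            qPoch ((y * q ^ j) ^ 2) q r := by
          rw [qPoch_add, e1, qPoch_succ, qPoch_add]
        rw [hE] at hA hA'
        have hA'' : qPoch (y ^ 2) q (j + r + j) = qPoch (y ^ 2 / q) q j *
            qPoch (y ^ 2 / q * q ^ j) q j * (1 - y ^ 2 / q * q ^ (j + j)) *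
            qPoch ((y * q ^ j) ^ 2) q r / (1 - y ^ 2 / q) := by
          rw [eq_div_iff ha1, ← hA']; ring
        have n1 := right_ne_zero_of_mul hA
        have n2 := right_ne_zero_of_mul (left_ne_zero_of_mul hA)
        have n3 := right_ne_zero_of_mul (left_ne_zero_of_mul (left_ne_zero_of_mul hA))
        have n4 := left_ne_zero_of_mul (left_ne_zero_of_mul (left_ne_zero_of_mul hA))
        have c1 : (j + 1).choose 2 = j + j.choose 2 := by
          rw [Nat.choose_succ_succ' j 1, Nat.choose_one_right]
        have e2 : (y * q ^ j) ^ 2 = y ^ 2 * (q ^ 2) ^ j := by ring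
        simp only [hf, watsonCoeff, vwpTerm, Nat.add_sub_cancel_left, hyt, hyt', c1]
        rw [hA'', qPoch_add (y ^ 2), ← e2, show 2 * j = j + j by ring]
        rw [qPoch_add (q * p)] at hps ⊢
        rw [qPoch_add z'] at hz's ⊢
        have n5 := left_ne_zero_of_mul hps
        have n6 := right_ne_zero_of_mul hps
        have n7 := left_ne_zero_of_mul hz's
        have n8 := right_ne_zero_of_mul hz's
        have n9 := hn j
        have n10 := hn r
        rw [pow_add q j r, pow_add q j (j.choose 2)]
        clear hA hA' hA'' hps hz's hv hl ha hy2
        generalize 1 - y ^ 2 / q * q ^ (j + j) = x1 at *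
        generalize qPoch (y ^ 2 / q * q ^ j) q j = x2 at *
        generalize qPoch (y ^ 2 / q) q j = x3 at *
        generalize 1 - y ^ 2 / q = x4 at *
        generalize qPoch (q * p * (q ^ 2) ^ j) (q ^ 2) r = x5 at *
        generalize qPoch (q * p) (q ^ 2) j = x6 at *
        generalize qPoch (z' * q ^ j) q r = x7 at *
        generalize qPoch ((y * q ^ j) ^ 2) q r = x8 at *
        generalize qPoch ((y * q ^ j) ^ 2) (q ^ 2) r = x9 at *
        generalize qPoch (y ^ 2) (q ^ 2) j = x10 at *
        field_simp
    _ = _ := by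
        rw [← Finset.mul_sum, hv, qPoch_sq]
        have := hn s
        generalize 1 - y ^ 2 / q = x4 at *
        generalize qPoch (q * p) (q ^ 2) s = x6 at *
        field_simp

/-! ### The outer sum -/

theorem choose_two_add (i r : ℕ) : (i + r).choose 2 = i.choose 2 + r.choose 2 + i * r := by
  induction r with
  | zero => simp
  | succ r ih =>
    rw [← add_assoc, Nat.choose_succ_succ' (i + r) 1, Nat.choose_succ_succ' r 1, ih,
      Nat.choose_one_right, Nat.choose_one_right]
    ring

/-- Up to a factor independent of `i`, the summand of `vwp_evaluation` is a `vwpTerm` with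
`b = β q^k`. The identity is multiplied by `(a; q)_ℓ`, which avoids the denominator
`(q^{1-ℓ-k} / a; q)_ℓ` of the corresponding `₆φ₅` sum; this can vanish. -/
theorem vwp_term_eq {q : ℂ} (hq0 : q ≠ 0) (hq : ∀ k : ℕ, 0 < k → q ^ k ≠ 1)
    {a c d w x β z : ℂ} {ℓ : ℕ} (ha : a ≠ 0) (hc : c ≠ 0) (hd : d * c * q ^ ℓ = q)
    (hw : w * a * q ^ ℓ = q) (hβ : β = d * a / c) (hz : z * q ^ ℓ = 1)
    (hx1 : 1 - x ≠ 0) (hd2 : qPoch (d ^ 2) q (2 * ℓ) ≠ 0) (hwl : qPoch w q ℓ ≠ 0)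
    (k i : ℕ) (hi : i ≤ ℓ) :
    qPoch a q ℓ * ((q ^ ℓ) ^ i * (c / a) ^ i * ((1 - x * q ^ (2 * i)) / (1 - x)) *
        (qPoch z q i * qPoch β q i * qPoch x q i /
          (qPoch q q i * qPoch w q i * qPoch (d ^ 2 * q ^ ℓ) q i)) *
        (qPoch (a * q ^ (ℓ - i)) q k * qPoch (β * q ^ i) q k)) =
      qPoch a q k * qPoch β q k * qPoch q q ℓ * qPoch (d ^ 2) q ℓ / (1 - x) *
        ((-(a * q ^ k)) ^ ℓ * q ^ ℓ.choose 2) *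
        vwpTerm q x (β * q ^ k) ((β * q ^ k)⁻¹) d ℓ i := by
  obtain ⟨r, rfl⟩ : ∃ r, ℓ = r + i := ⟨ℓ - i, by omega⟩
  have hn := qPoch_self_ne_zero hq
  have hd0 : d ≠ 0 := by rintro rfl; simp at hd; exact hq0 hd.symm
  have hqk : q ^ k ≠ 0 := pow_ne_zero _ hq0
  have hdt : d * (β * q ^ k)⁻¹ = c / (a * q ^ k) := by rw [hβ]; field_simp
  have hwi := qPoch_ne_zero_of_le hwl hi
  have r1 := qPoch_reverse (q * q ^ r) z i (by linear_combination q * hz) hq0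
  have r2 := qPoch_reverse w (a * q ^ r) i (by linear_combination hw) hq0
  have r3 := qPoch_reverse (d ^ 2 * (β * q ^ k)⁻¹ * q ^ i) (a * q ^ k) r (by
    rw [show d ^ 2 * (β * q ^ k)⁻¹ = d * (d * (β * q ^ k)⁻¹) by ring, hdt]
    field_simp
    linear_combination hd) hq0
  have s1 : qPoch a q r * qPoch (a * q ^ r) q k = qPoch a q k * qPoch (a * q ^ k) q r := by
    rw [← qPoch_add, ← qPoch_add, add_comm]
  have s2 : qPoch β q i * qPoch (β * q ^ i) q k = qPoch β q k * qPoch (β * q ^ k) q i := by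
    rw [← qPoch_add, ← qPoch_add, add_comm]
  have s3 : qPoch (d ^ 2) q (r + i + i) =
    qPoch (d ^ 2) q (r + i) * qPoch (d ^ 2 * q ^ (r + i)) q i := qPoch_add _ _ _ _
  have h1 := qPoch_ne_zero_of_le hd2 (show r + i + i ≤ _ by omega)
  rw [s3] at h1
  have h2 := left_ne_zero_of_mul h1
  have h3 := right_ne_zero_of_mul h1
  have hz' : z * q ^ r * q ^ i = 1 := by rw [← hz]; ring
  have hzi : (-z) ^ i * (q ^ (r + i)) ^ i = (-1) ^ i := by
    rw [← mul_pow]; congr 1; linear_combination -hz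
  -- the powers of `q` combine to a factor that does not depend on `i`
  have hsc : (q ^ (r + i)) ^ i * (c / a) ^ i * ((-z) ^ i * q ^ i.choose 2) *
      ((-(a * q ^ r)) ^ i * q ^ i.choose 2) * ((-(a * q ^ k)) ^ r * q ^ r.choose 2) =
      (-(a * q ^ k)) ^ (r + i) * q ^ (r + i).choose 2 *
        ((-(c / (a * q ^ k))) ^ i * q ^ i.choose 2) := by
    have e1 : (-(a * q ^ k)) ^ (r + i) * (-(c / (a * q ^ k))) ^ i =
        (-(a * q ^ k)) ^ r * c ^ i := by
      rw [pow_add, mul_assoc, ← mul_pow]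
      congr 2
      field_simp
    have e2 : (c / a) ^ i * (-(a * q ^ r)) ^ i = (-1) ^ i * c ^ i * q ^ (r * i) := by
      rw [pow_mul, ← mul_pow, ← mul_pow, ← mul_pow]
      congr 1
      field_simp
    have e3 : ((-1 : ℂ)) ^ i * (-1) ^ i = 1 := by rw [← mul_pow]; simp
    rw [choose_two_add, pow_add, pow_add]
    calc _ = ((-z) ^ i * (q ^ (r + i)) ^ i) * ((c / a) ^ i * (-(a * q ^ r)) ^ i) *
          q ^ i.choose 2 * q ^ i.choose 2 * ((-(a * q ^ k)) ^ r * q ^ r.choose 2) := by ring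
      _ = (((-1 : ℂ)) ^ i * (-1) ^ i) * c ^ i * q ^ (r * i) * q ^ i.choose 2 * q ^ i.choose 2 *
          ((-(a * q ^ k)) ^ r * q ^ r.choose 2) := by rw [hzi, e2]; ring
      _ = ((-(a * q ^ k)) ^ r * c ^ i) * q ^ (r * i) * q ^ i.choose 2 * q ^ i.choose 2 *
          q ^ r.choose 2 := by rw [e3]; ring
      _ = _ := by rw [← e1]; ring
  simp only [vwpTerm, hdt, Nat.add_sub_cancel]
  rw [r1, s3]
  calc _ = (qPoch (a * q ^ r) q i / qPoch w q i) * (qPoch a q r * qPoch (a * q ^ r) q k) *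
        (qPoch β q i * qPoch (β * q ^ i) q k) * ((q ^ (r + i)) ^ i * (c / a) ^ i *
        ((-z) ^ i * q ^ i.choose 2)) * qPoch (q * q ^ r) q i *
        ((1 - x * q ^ (2 * i)) / (1 - x) * qPoch x q i /
          (qPoch q q i * qPoch (d ^ 2 * q ^ (r + i)) q i)) := by
        rw [qPoch_add a q r i]
        ring
    _ = ((q ^ (r + i)) ^ i * (c / a) ^ i * ((-z) ^ i * q ^ i.choose 2) *
      ((-(a * q ^ r)) ^ i * q ^ i.choose 2) * ((-(a * q ^ k)) ^ r * q ^ r.choose 2)) *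
        (qPoch a q k * qPoch (d ^ 2 * (β * q ^ k)⁻¹ * q ^ i) q r) *
        (qPoch β q k * qPoch (β * q ^ k) q i) * qPoch (q * q ^ r) q i *
        ((1 - x * q ^ (2 * i)) / (1 - x) * qPoch x q i /
          (qPoch q q i * qPoch (d ^ 2 * q ^ (r + i)) q i)) := by
        rw [s1, s2, r3, show qPoch (a * q ^ r) q i / qPoch w q i =
          (-(a * q ^ r)) ^ i * q ^ i.choose 2 by rw [r2]; field_simp]
        ring
    _ = _ := by
        rw [hsc, qPoch_add q q r i]
        have := hn r
        have := hn i
        generalize qPoch (d ^ 2 * (β * q ^ k)⁻¹ * q ^ i) q r = x1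
        generalize (-(a * q ^ k)) ^ (r + i) * q ^ (r + i).choose 2 = x2
        generalize (-(c / (a * q ^ k))) ^ i = x3
        generalize qPoch (d ^ 2 * q ^ (r + i)) q i = x4 at *
        generalize qPoch (d ^ 2) q (r + i) = x5 at *
        generalize qPoch (q * q ^ r) q i = x6 at *
        clear hsc r1 r2 r3 s1 s2 s3 h1 hd2 hdt hzi hz hz' hβ hw hd
        field_simp

/-- The sum over `i` for fixed `k`. Here `d = q^{1-ℓ} / c`, `w = q^{1-ℓ} / a`, `x = q^{1-2ℓ} / c²`,
`z = q^{-ℓ}`, `e = q^{ℓ-1} c²`, and `a q^{ℓ-i}`, `β q^i` are the parameters `u`, `v`. -/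
theorem vwp_evaluation {q : ℂ} (hq0 : q ≠ 0) (hq : ∀ k : ℕ, 0 < k → q ^ k ≠ 1)
    {a c d w x β z e D : ℂ} {ℓ : ℕ} (ha : a ≠ 0) (hc : c ≠ 0) (hd : d * c * q ^ ℓ = q)
    (hw : w * a * q ^ ℓ = q) (hβ : β = d * a / c) (hz : z * q ^ ℓ = 1) (hx : x * q = d ^ 2)
    (he : e * d ^ 2 * q ^ ℓ = q) (hD : D = d * a)
    (hx1 : 1 - x ≠ 0) (hel : qPoch e q ℓ ≠ 0) (hdl : qPoch (d ^ 2 * q ^ ℓ) q ℓ ≠ 0)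
    (hwl : qPoch w q ℓ ≠ 0) (hDl : qPoch D q ℓ ≠ 0) (k : ℕ) (hDk : qPoch D q k ≠ 0) :
    qPoch a q ℓ * qPoch c q ℓ / (qPoch e q ℓ * qPoch D q ℓ) *
      ∑ i ∈ range (ℓ + 1), (q ^ ℓ) ^ i * (c / a) ^ i * ((1 - x * q ^ (2 * i)) / (1 - x)) *
        (qPoch z q i * qPoch β q i * qPoch x q i /
          (qPoch q q i * qPoch w q i * qPoch (d ^ 2 * q ^ ℓ) q i)) *
        (qPoch (a * q ^ (ℓ - i)) q k * qPoch (β * q ^ i) q k) =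
    qPoch a q k * qPoch β q k * qPoch (q * a / c) q k / qPoch D q k := by
  have hd0 : d ≠ 0 := by rintro rfl; simp at hd; exact hq0 hd.symm
  have hqk : q ^ k ≠ 0 := pow_ne_zero _ hq0
  have hql : q ^ ℓ ≠ 0 := pow_ne_zero _ hq0
  have hqc : q ^ ℓ.choose 2 ≠ 0 := pow_ne_zero _ hq0
  have hdt : d * (β * q ^ k)⁻¹ = c / (a * q ^ k) := by rw [hβ]; field_simp
  have hb0 : β * q ^ k ≠ 0 := by rw [hβ]; positivity
  have r1 := qPoch_reverse (D * q ^ k) (c / (a * q ^ k)) ℓ (by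
    rw [hD]; field_simp; linear_combination hd) hq0
  have r2 := qPoch_reverse c d ℓ (by linear_combination hd) hq0
  have r3 := qPoch_reverse e (d ^ 2) ℓ he hq0
  have hd2 : qPoch (d ^ 2) q (2 * ℓ) ≠ 0 := by
    rw [two_mul, qPoch_add, r3]
    have : (-d ^ 2) ^ ℓ ≠ 0 := pow_ne_zero _ (neg_ne_zero.2 (pow_ne_zero _ hd0))
    positivity
  have hdn := qPoch_ne_zero_of_sq hd2
  have hcl : qPoch c q ℓ ≠ 0 := by rw [r2] at hdn; exact right_ne_zero_of_mul hdn
  have hv := sum_vwp hq x (β * q ^ k) ((β * q ^ k)⁻¹) d hx (mul_inv_cancel₀ hb0) ℓ hd2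
  have hs : qPoch D q k * qPoch (D * q ^ k) q ℓ = qPoch D q ℓ * qPoch (q * a / c) q k := by
    rw [← qPoch_add, add_comm, qPoch_add]
    congr 2
    rw [hD]; field_simp; linear_combination hd
  have hsc : (-d ^ 2) ^ ℓ * (-(c / (a * q ^ k))) ^ ℓ * (-(a * q ^ k)) ^ ℓ * (q ^ ℓ.choose 2) ^ 2 =
      (-d) ^ ℓ := by
    have e1 : (q ^ ℓ.choose 2) ^ 2 * q ^ ℓ = (q ^ ℓ) ^ ℓ := by
      rw [← pow_mul, ← pow_add, ← pow_mul]
      congr 1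
      have : ℓ.choose 2 * 2 = ℓ * (ℓ - 1) := by
        rw [Nat.choose_two_right, Nat.div_mul_cancel (Nat.even_mul_pred_self ℓ).two_dvd]
      rw [this]
      cases ℓ with
      | zero => rfl
      | succ n => simp; ring
    apply mul_right_cancel₀ hql
    rw [mul_assoc _ _ (q ^ ℓ), e1, ← mul_pow, ← mul_pow, ← mul_pow, ← mul_pow]
    congr 1
    field_simp
    linear_combination -hd
  rw [Finset.mul_sum]
  calc _ = qPoch c q ℓ / (qPoch e q ℓ * qPoch D q ℓ) * ∑ i ∈ range (ℓ + 1),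
        qPoch a q k * qPoch β q k * qPoch q q ℓ * qPoch (d ^ 2) q ℓ / (1 - x) *
        ((-(a * q ^ k)) ^ ℓ * q ^ ℓ.choose 2) *
        vwpTerm q x (β * q ^ k) ((β * q ^ k)⁻¹) d ℓ i := by
        rw [Finset.mul_sum]
        refine Finset.sum_congr rfl fun i hi => ?_
        rw [← vwp_term_eq hq0 hq ha hc hd hw hβ hz hx1 hd2 hwl k i
          (by simpa [Nat.lt_succ_iff] using hi)]
        ring
    _ = _ := by
        rw [← Finset.mul_sum, hv, hdt, r1, r2, r3, eq_div_iff hDk]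
        have hnl := qPoch_self_ne_zero hq ℓ
        have hnd : (-d) ^ ℓ ≠ 0 := pow_ne_zero _ (neg_ne_zero.2 hd0)
        calc _ = qPoch a q k * qPoch β q k / qPoch D q ℓ *
              (qPoch D q k * qPoch (D * q ^ k) q ℓ) * (((-d ^ 2) ^ ℓ *
              (-(c / (a * q ^ k))) ^ ℓ * (-(a * q ^ k)) ^ ℓ * (q ^ ℓ.choose 2) ^ 2) / (-d) ^ ℓ) := by
              generalize (-(c / (a * q ^ k))) ^ ℓ = x1
              generalize (-(a * q ^ k)) ^ ℓ = x2
              generalize qPoch (D * q ^ k) q ℓ = x3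
              generalize (-d ^ 2) ^ ℓ = x4
              generalize (-d) ^ ℓ = x5 at *
              clear hsc hs hd2 r1 r2 r3 hdt hb0 hdl hv
              field_simp
          _ = _ := by
              rw [hsc, hs]
              field_simp

/-! ### The transformation formula -/

/-- Truncation of a basic hypergeometric series that contains the numerator parameter `q⁻ⁿ`. -/
theorem basicHyp_four_three_eq_sum {q : ℂ} (x₁ x₂ z x₄ y₁ y₂ y₃ : ℂ) (n : ℕ) (hz : z * q ^ n = 1) :
    basicHyp ![x₁, x₂, z, x₄] ![y₁, y₂, y₃] q q =
      ∑ k ∈ range (n + 1), qPoch z q k * q ^ k / qPoch y₃ q k *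
        (qPoch x₁ q k * qPoch x₂ q k * qPoch x₄ q k) /
        (qPoch q q k * qPoch y₁ q k * qPoch y₂ q k) := by
  rw [basicHyp, tsum_eq_sum (s := range (n + 1))]
  · refine Finset.sum_congr rfl fun k _ => ?_
    simp [qFrac, Fin.prod_univ_succ]
    ring
  · intro k hk
    have : qPoch z q k = 0 := qPoch_eq_zero (k := n) (by simpa using hk) hz
    simp [qFrac, Fin.prod_univ_succ, this]

theorem theorem9 (q a c : ℂ) (ℓ m n : ℕ)
    -- the base is nonzero and not a root of unity
    (hq0 : q ≠ 0) (hq : ∀ k : ℕ, 0 < k → q ^ k ≠ 1)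
    (ha : a ≠ 0) (hc : c ≠ 0)
    -- no zero factors in the denominators of the (terminating) series on the left
    (hL1 : qPoch (q ^ (1 - ℓ : ℤ) * a / c) q n ≠ 0)
    (hL2 : qPoch (q ^ (1 + m + n : ℤ) * a) q n ≠ 0)
    (hL3 : qPoch (-q ^ (-n : ℤ) * c) q n ≠ 0)
    -- no zero factors in the denominators on the right
    (hR1 : qPoch (q ^ (ℓ - 1 : ℤ) * c ^ 2) q ℓ ≠ 0)
    (hR2 : qPoch (q ^ (1 - ℓ : ℤ) * a / c) q ℓ ≠ 0)
    (hR3 : qPoch (-q / c) q n ≠ 0)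
    (hR4 : 1 - q ^ (1 - 2 * ℓ : ℤ) / c ^ 2 ≠ 0)
    (hR5 : qPoch (q ^ (1 - ℓ : ℤ) / a) q ℓ ≠ 0)
    (hR6 : qPoch (q ^ (2 - ℓ : ℤ) / c ^ 2) q ℓ ≠ 0)
    (hR7 : qPoch (q * a / c) q m ≠ 0)
    (hR8 : qPoch (-q * a / c) q m ≠ 0)
    (hR9 : ∀ j ≤ m, qPoch (q ^ (2 + 2 * j : ℤ) * a ^ 2 / c ^ 2) (q ^ 2) (m + n - j) ≠ 0) :
    basicHyp
        ![a, c, q ^ (-n : ℤ), -q ^ (1 - ℓ + m + n : ℤ) * a / c]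
        ![q ^ (1 - ℓ : ℤ) * a / c, q ^ (1 + m + n : ℤ) * a, -q ^ (-n : ℤ) * c] q q =
      qFrac ![a, c] ![q ^ (ℓ - 1 : ℤ) * c ^ 2, q ^ (1 - ℓ : ℤ) * a / c] q ℓ *
      qFrac ![q ^ (1 + m + n : ℤ), -q * a / c] ![q ^ (1 + m + n : ℤ) * a, -q / c] q n *
      ∑ i ∈ Finset.range (ℓ + 1), ∑ j ∈ Finset.range (m + 1),
        (-1) ^ j * q ^ (ℓ * i - n * j + (j + 1).choose 2 : ℤ) * (c / a) ^ i *
        ((1 - q ^ (1 - 2 * ℓ + 2 * i : ℤ) / c ^ 2) / (1 - q ^ (1 - 2 * ℓ : ℤ) / c ^ 2)) *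
        qFrac
          ![q ^ (-ℓ : ℤ), q ^ (1 - ℓ : ℤ) * a / c ^ 2, q ^ (1 - 2 * ℓ : ℤ) / c ^ 2]
          ![q, q ^ (1 - ℓ : ℤ) / a, q ^ (2 - ℓ : ℤ) / c ^ 2] q i *
        qFrac
          ![q ^ (-m : ℤ), q ^ (-m - n : ℤ), -q ^ (-m - n : ℤ), q ^ (ℓ - i : ℤ) * a,
            q ^ (1 - ℓ + i : ℤ) * a / c ^ 2]
          ![q, q * a / c, -q * a / c, q ^ (-m - 2 * n : ℤ), q ^ (j - 2 * m - 2 * n - 1 : ℤ)] q j *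
        qFrac
          ![q ^ (1 + ℓ - i + j : ℤ) * a, q ^ (2 - ℓ + i + j : ℤ) * a / c ^ 2]
          ![q, q ^ (2 + 2 * j : ℤ) * a ^ 2 / c ^ 2] (q ^ 2) (m + n - j) := by
  set z := q ^ (-n : ℤ) with hz
  set y := q ^ (-m - n : ℤ) with hy
  set b := q ^ (-m : ℤ) with hb
  set z' := q ^ (-m - 2 * n : ℤ) with hz'
  set zl := q ^ (-ℓ : ℤ) with hzl
  set d := q ^ (1 - ℓ : ℤ) / c with hd
  set D := q ^ (1 - ℓ : ℤ) * a / c with hD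
  set E := q ^ (1 + m + n : ℤ) * a with hE
  set x := q ^ (1 - 2 * ℓ : ℤ) / c ^ 2 with hx
  set w := q ^ (1 - ℓ : ℤ) / a with hw
  set e := q ^ (ℓ - 1 : ℤ) * c ^ 2 with he
  set β := q ^ (1 - ℓ : ℤ) * a / c ^ 2 with hβ
  set p := q * a ^ 2 / c ^ 2 with hp
  have hzn : z * q ^ n = 1 := by
    rw [hz, ← zpow_natCast, ← zpow_add₀ hq0]; simp
  have hbm : b * q ^ m = 1 := by
    rw [hb, ← zpow_natCast, ← zpow_add₀ hq0]; simp
  have hzl1 : zl * q ^ ℓ = 1 := by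
    rw [hzl, ← zpow_natCast, ← zpow_add₀ hq0]; simp
  have hyM : y * q ^ (m + n) = 1 := by
    rw [hy, ← zpow_natCast, ← zpow_add₀ hq0]; push_cast; ring_nf; simp
  have hz'1 : z' * q ^ (m + n + n) = 1 := by
    rw [hz', ← zpow_natCast, ← zpow_add₀ hq0]; push_cast; ring_nf; simp
  have hP : q ^ (1 - ℓ : ℤ) * q ^ ℓ = q := by
    rw [← zpow_natCast, ← zpow_add₀ hq0]; simp
  have hP1 : q ^ (1 - 2 * ℓ : ℤ) * q = (q ^ (1 - ℓ : ℤ)) ^ 2 := by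
    rw [← zpow_natCast, ← zpow_mul, ← zpow_add_one₀ hq0]; congr 1; push_cast; ring
  have hP2 : q ^ (ℓ - 1 : ℤ) * q ^ (1 - ℓ : ℤ) = 1 := by
    rw [← zpow_add₀ hq0]; simp
  have hP3 : q ^ (2 - ℓ : ℤ) = q * q ^ (1 - ℓ : ℤ) := by
    rw [← zpow_one_add₀ hq0]; congr 1; ring
  have hP4 : q ^ (1 + m + n : ℤ) = q ^ (1 + m + n) := by
    rw [← zpow_natCast]; push_cast; rfl
  have hdc : d * c * q ^ ℓ = q := by rw [hd, div_mul_cancel₀ _ hc, hP]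
  have hwa : w * a * q ^ ℓ = q := by rw [hw, div_mul_cancel₀ _ ha, hP]
  have hβd : β = d * a / c := by rw [hβ, hd]; field_simp
  have hDd : D = d * a := by rw [hD, hd]; field_simp
  have hxd : x * q = d ^ 2 := by rw [hx, hd, div_pow, ← hP1]; ring
  have hed : e * d ^ 2 * q ^ ℓ = q := by
    rw [he, hd]
    field_simp
    linear_combination q ^ (ℓ - 1 : ℤ) * q ^ (1 - ℓ : ℤ) * hP + q * hP2
  have hdl : q ^ (2 - ℓ : ℤ) / c ^ 2 = d ^ 2 * q ^ ℓ := by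
    rw [hP3, hd]
    field_simp
    linear_combination -hP
  have hqp : q * p = (q * a / c) ^ 2 := by rw [hp]; ring
  have hpM : qPoch (q * p) (q ^ 2) (m + n) ≠ 0 := by
    have := hR9 0 m.zero_le
    rw [Nat.sub_zero] at this
    rw [hqp]
    convert this using 2
    rw [show (2 + 2 * ((0 : ℕ) : ℤ)) = ((2 : ℕ) : ℤ) by norm_num, zpow_natCast]
    ring
  -- the factor for `j = 0` in the last denominator on the right controls the indices up to `m + n`
  have hpn : ∀ k ≤ n, qPoch (q * a / c) q k ≠ 0 ∧ qPoch (-(q * a / c)) q k ≠ 0 := by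
    intro k hk
    have := qPoch_ne_zero_of_le hpM (show k ≤ m + n by omega)
    rw [hqp, qPoch_sq] at this
    exact ⟨left_ne_zero_of_mul this, right_ne_zero_of_mul this⟩
  rw [hdl] at hR6
  -- the left-hand side, after Sears' transformation
  have hleft := sum_sears hq0 hq a (-y) β (-(q ^ (m + n) * c)) (-z * c) (-q / c) z' z D E n hzn
    (by field_simp; linear_combination hzn)
    (by
      rw [show -(q ^ (m + n) * c) * (-q / c) = q ^ (m + n) * q by field_simp]
      linear_combination q * hz'1)
    (by
      rw [hDd, hβd]
      field_simp
      linear_combination -d * hyM)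
    (by
      rw [hE, hP4, show a * -(q ^ (m + n) * c) * (-q / c) = a * (q ^ (m + n) * q) by field_simp]
      ring)
    hL1 hL2 hR3
    (by
      rw [show -(q ^ (m + n) * c) * (-q / c) = q * q ^ (m + n) by field_simp]
      have := qPoch_self_ne_zero hq (m + n + n)
      rw [qPoch_add] at this
      exact right_ne_zero_of_mul this)
    (by
      rw [show a * (-q / c) = -(q * a / c) by ring]
      exact (hpn n le_rfl).2)
  have g1 : -y * -(q ^ (m + n) * c) = c := by linear_combination c * hyM
  have g2 : β * -(q ^ (m + n) * c) = -q ^ (1 - ℓ + m + n : ℤ) * a / c := by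
    rw [show (1 - ℓ + m + n : ℤ) = (1 - ℓ) + ((m + n : ℕ) : ℤ) by push_cast; ring,
      zpow_add₀ hq0, zpow_natCast, hβ]
    field_simp
  have g3 : -(q ^ (m + n) * c) * (-q / c) = q ^ (1 + m + n : ℤ) := by
    rw [hP4]; field_simp; ring
  have g4 : a * (-q / c) = -q * a / c := by ring
  rw [g1, g2, g3, g4] at hleft
  rw [basicHyp_four_three_eq_sum _ _ _ _ _ _ _ n hzn, hleft]
  -- the inner sum over `j` on the right-hand side
  have hinner : ∀ i ∈ range (ℓ + 1), ∑ j ∈ range (m + 1),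
        (-1) ^ j * q ^ (ℓ * i - n * j + (j + 1).choose 2 : ℤ) * (c / a) ^ i *
        ((1 - q ^ (1 - 2 * ℓ + 2 * i : ℤ) / c ^ 2) / (1 - x)) *
        qFrac ![zl, β, x] ![q, w, q ^ (2 - ℓ : ℤ) / c ^ 2] q i *
        qFrac
          ![b, y, -y, q ^ (ℓ - i : ℤ) * a, q ^ (1 - ℓ + i : ℤ) * a / c ^ 2]
          ![q, q * a / c, -q * a / c, z', q ^ (j - 2 * m - 2 * n - 1 : ℤ)] q j *
        qFrac
          ![q ^ (1 + ℓ - i + j : ℤ) * a, q ^ (2 - ℓ + i + j : ℤ) * a / c ^ 2]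
          ![q, q ^ (2 + 2 * j : ℤ) * a ^ 2 / c ^ 2] (q ^ 2) (m + n - j) =
      ∑ k ∈ range (n + 1), qPoch z q k * q ^ k * qPoch (-y) q k /
          (qPoch q q k * qPoch z' q k * qPoch (q * p) (q ^ 2) k) *
        ((q ^ ℓ) ^ i * (c / a) ^ i * ((1 - x * q ^ (2 * i)) / (1 - x)) *
        (qPoch zl q i * qPoch β q i * qPoch x q i /
          (qPoch q q i * qPoch w q i * qPoch (d ^ 2 * q ^ ℓ) q i)) *
        (qPoch (a * q ^ (ℓ - i)) q k * qPoch (β * q ^ i) q k)) := by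
    intro i hi
    have hi : i ≤ ℓ := by simpa [Nat.lt_succ_iff] using hi
    have u1 : q ^ (ℓ - i : ℤ) * a = a * q ^ (ℓ - i) := by
      rw [← zpow_natCast, Nat.cast_sub hi]; ring
    have v1 : q ^ (1 - ℓ + i : ℤ) * a / c ^ 2 = β * q ^ i := by
      rw [zpow_add₀ hq0, zpow_natCast, hβ]; ring
    have huv : p = a * q ^ (ℓ - i) * (β * q ^ i) := by
      have : q ^ (ℓ - i) * q ^ i = q ^ ℓ := by rw [← pow_add, Nat.sub_add_cancel hi]
      rw [hp, hβ]
      field_simp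
      linear_combination -q ^ (1 - ℓ : ℤ) * this - hP
    have hexp := sum_watson_expansion hq0 hq (a * q ^ (ℓ - i)) (β * q ^ i) p b y z z' huv m n
      hbm hyM hzn hz'1 hpM
    have hx2 : q ^ (1 - 2 * ℓ + 2 * i : ℤ) / c ^ 2 = x * q ^ (2 * i) := by
      rw [show (1 - 2 * ℓ + 2 * i : ℤ) = (1 - 2 * ℓ) + ((2 * i : ℕ) : ℤ) by push_cast; ring,
        zpow_add₀ hq0, zpow_natCast, hx]
      ring
    have hconst := congrArg (fun s => (q ^ ℓ) ^ i * (c / a) ^ i *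
      ((1 - x * q ^ (2 * i)) / (1 - x)) * (qPoch zl q i * qPoch β q i * qPoch x q i /
          (qPoch q q i * qPoch w q i * qPoch (d ^ 2 * q ^ ℓ) q i)) * s) hexp
    simp only [Finset.mul_sum] at hconst
    refine Eq.trans (Finset.sum_congr rfl fun j hj => ?_) (hconst.trans ?_)
    · have u2 : q ^ (1 + ℓ - i + j : ℤ) * a = q * (a * q ^ (ℓ - i) * q ^ j) := by
        rw [← u1, show (1 + ℓ - i + j : ℤ) = 1 + (ℓ - i) + (j : ℕ) by ring, zpow_add₀ hq0,
          zpow_natCast, zpow_one_add₀ hq0]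
        ring
      have v2 : q ^ (2 - ℓ + i + j : ℤ) * a / c ^ 2 = q * (β * q ^ i * q ^ j) := by
        rw [← v1, show (2 - ℓ + i + j : ℤ) = 1 + (1 - ℓ + i) + (j : ℕ) by ring, zpow_add₀ hq0,
          zpow_natCast, zpow_one_add₀ hq0]
        ring
      have p2 : q ^ (2 + 2 * j : ℤ) * a ^ 2 / c ^ 2 = q * p * (q ^ 2) ^ j := by
        rw [show (2 + 2 * j : ℤ) = ((2 + 2 * j : ℕ) : ℤ) by push_cast; rfl, zpow_natCast, hp]
        ring
      have y2 : q ^ (j - 2 * m - 2 * n - 1 : ℤ) = y ^ 2 / q * q ^ j := by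
        rw [show (j - 2 * m - 2 * n - 1 : ℤ) = (-m - n) * (2 : ℕ) - 1 + (j : ℕ) by push_cast; ring,
          zpow_add₀ hq0, zpow_natCast, zpow_sub_one₀ hq0, zpow_mul, zpow_natCast, hy]
        ring
      have s2 : q ^ (ℓ * i - n * j + (j + 1).choose 2 : ℤ) =
          (q ^ ℓ) ^ i * z ^ j * q ^ (j + 1).choose 2 := by
        rw [zpow_add₀ hq0, zpow_natCast,
          show (ℓ * i - n * j : ℤ) = ((ℓ * i : ℕ) : ℤ) + (-n) * (j : ℕ) by push_cast; ring,
          zpow_add₀ hq0, zpow_natCast, pow_mul, zpow_mul, zpow_natCast, hz]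
      rw [u1, v1, u2, v2, p2, y2, s2, hx2, hdl, watsonCoeff, qPoch_sq y, hqp, qPoch_sq (q * a / c),
        show -(q * a / c) = -q * a / c by ring]
      simp only [qFrac, Fin.prod_univ_succ, Matrix.cons_val_zero, Matrix.cons_val_succ,
        Finset.univ_eq_empty, Finset.prod_empty, mul_one]
      rw [show (-z) ^ j = (-1) ^ j * z ^ j by rw [← mul_pow]; congr 1; ring]
      generalize (a * q ^ (ℓ - i)) = U
      generalize q * a / c = W
      generalize -q * a / c = W'
      generalize y ^ 2 / q * q ^ j = Y
      ring
    · refine Finset.sum_congr rfl fun k _ => ?_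
      ring
  rw [Finset.sum_congr rfl hinner, Finset.sum_comm]
  simp only [← Finset.mul_sum]
  simp only [qFrac, Fin.prod_univ_succ, Matrix.cons_val_zero, Matrix.cons_val_succ,
        Finset.univ_eq_empty, Finset.prod_empty, mul_one]
  -- the sum over `i`, term by term
  rw [mul_comm (qPoch a q ℓ * qPoch c q ℓ / (qPoch e q ℓ * qPoch D q ℓ)), mul_assoc,
    mul_comm (qPoch E q n)]
  congr 1
  rw [Finset.mul_sum]
  refine Finset.sum_congr rfl fun k hk => ?_
  have hk : k ≤ n := by simpa [Nat.lt_succ_iff] using hk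
  have hv := vwp_evaluation hq0 hq ha hc hdc hwa hβd hzl1 hxd hed hDd hR4 hR1 hR6 hR5 hR2 k
    (qPoch_ne_zero_of_le hL1 hk)
  rw [mul_left_comm (qPoch a q ℓ * qPoch c q ℓ / _), hv, hqp, qPoch_sq,
    show -(q * a / c) = -q * a / c by ring]
  have := (hpn k hk).1
  generalize qPoch (q * a / c) q k = W at *
  generalize qPoch (-q * a / c) q k = W' at *
  field_simp
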